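/- **Theorem.** Let $\Omega\subset\mathbb R^d$ be a bounded open set (for instance a bounded Lipschitz domain, $d\in\{1,2,3\}$; no regularity of the boundary is needed), and let $(\cdot,\cdot)$ and $\|\cdot\|$ denote the inner products and norms of $L^2(\Omega)$ and $[L^2(\Omega)]^d$. Let $V=H^1_0(\Omega)$ be the closure of $C_c^\infty(\Omega)$ in $H^1(\Omega)$, and let $H(\mathrm{div},\Omega)=\{\tau\in[L^2(\Omega)]^d:\ \mathrm{div}\,\tau\in L^2(\Omega)\}$ with the weak divergence. Let $y_d,u_d,f\in L^2(\Omega)$, $\lambda>0$, let $u_a,u_b\in L^2(\Omega)$ satisfy $u_a\le u_b$ a.e., put $U_{\rm ad}=\{v\in L^2(\Omega): u_a\le v\le u_b \text{ a.e. in }\Omega\}$, and let $\nu:\Omega\to\mathbb R$ be measurable with $0<\underline\nu\le\nu(x)\le\overline\nu$ for $x\in\Omega$, where $\underline\nu,\overline\nu$ are constants. For $v\in L^2(\Omega)$ the state $y(v)\in V$ is the weak solution of $-\mathrm{div}(\nu\nabla y)=f+v$ in $\Omega$, $y=0$ on $\partial\Omega$, that is $$(\nu\nabla y(v),\nabla w)=(f+v,w)\qquad\text{for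 all } w\in V .$$ Let $u\in U_{\rm ad}$ be the optimal control, i.e. the minimizer over $v\in U_{\rm ad}$ of $$\mathcal J(y(v),v)=\tfrac12\|y(v)-y_d\|^2+\tfrac\lambda2\|v-u_d\|^2 ,$$ and let $C_F>0$ be any constant with $\|w\|\le C_F\|\nabla w\|$ for all $w\in V$ (Friedrichs inequality). For $\zeta\in V$ put $$v_\zeta(x)=\min\Big\{u_b(x),\max\big\{u_a(x),\,u_d(x)-\tfrac1\lambda\zeta(x)\big\}\Big\}\quad\text{for a.e. }x\in\Omega .$$ For $\alpha,\beta>0$, $\eta,\zeta\in V$, $\tau,\rho\in H(\mathrm{div},\Omega)$ and $v\in L^2(\Omega)$ define $$\mathcal J^\oplus=\tfrac{1+\alpha}{2}\|\eta-y_d\|^2+\tfrac{(1+\alpha)(1+\beta)C_F^2}{2\alpha\underline\nu^2}\|\tau-\nu\nabla\eta\|^2+\tfrac{(1+\alpha)(1+\beta)C_F^4}{2\alpha\beta\underline\nu^2}\|f+v+\mathrm{div}\,\tau\|^2+\tfrac\lambda2\|v-u_d\|^2,$$ $$\mathcal J^\ominus=\tfrac12\|\eta-y_d\|^2+\tfrac\lambda2\|v-u_d\|^2+(f+v+\mathrm{div}\,\tau,\zeta)+(\tau-\nu\nabla\eta,\nabla\zeta)-R,$$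 $$R=\tfrac1{\underline\nu}\big(C_F\|\eta-y_d+\mathrm{div}\,\rho\|+\|\rho-\nu\nabla\zeta\|\big)\Big(\tfrac{C_F^3}{\lambda\underline\nu}\|\eta-y_d+\mathrm{div}\,\rho\|+\tfrac{C_F^2}{\lambda\underline\nu}\|\rho-\nu\nabla\zeta\|+C_F\|f+v+\mathrm{div}\,\tau\|+\|\tau-\nu\nabla\eta\|\Big).$$ Then, for all $\eta,\zeta\in V$, $\tau,\rho\in H(\mathrm{div},\Omega)$ and $\alpha,\beta>0$, one has $v_\zeta\in U_{\rm ad}$ and, with $v=v_\zeta$ in the definitions above, $$|||u-v_\zeta|||^2:=\tfrac12\|y(u)-y(v_\zeta)\|^2+\tfrac\lambda2\|u-v_\zeta\|^2\ \le\ \mathcal M^\oplus:=\mathcal J^\oplus-\mathcal J^\ominus ,$$ where explicitly $$\mathcal M^\oplus=\tfrac\alpha2\|\eta-y_d\|^2+\tfrac{(1+\alpha)(1+\beta)C_F^2}{2\alpha\underline\nu^2}\|\tau-\nu\nabla\eta\|^2+\tfrac{(1+\alpha)(1+\beta)C_F^4}{2\alpha\beta\underline\nu^2}\|f+v_\zeta+\mathrm{div}\,\tau\|^2-(f+v_\zeta+\mathrm{div}\,\tau,\zeta)-(\tau-\nu\nabla\eta,\nabla\zeta)+R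 .$$ -/

import Mathlib

open MeasureTheory TopologicalSpace
open scoped Distributions Gradient RealInnerProductSpace ENNReal

noncomputable section

namespace EllipticControl

/-- Euclidean space `ℝᵈ`. -/
abbrev Eu (d : ℕ) : Type := EuclideanSpace ℝ (Fin d)

/-- The real Hilbert space `L²(Ω)`. -/
abbrev L2 {d : ℕ} (Ω : Opens (Eu d)) : Type :=
  Lp ℝ 2 (volume.restrict (Ω : Set (Eu d)))

/-- The real Hilbert space `[L²(Ω)]ᵈ` of square integrable vector fields. -/
abbrev L2Vec {d : ℕ} (Ω : Opens (Eu d)) : Type :=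
  Lp (Eu d) 2 (volume.restrict (Ω : Set (Eu d)))

/-- `L²(Ω) × [L²(Ω)]ᵈ` with `‖(w, g)‖² = ‖w‖² + ‖g‖²`. On pairs `(w, ∇w)` this is the
norm of `H¹(Ω)`. -/
abbrev L2Pair {d : ℕ} (Ω : Opens (Eu d)) : Type := WithLp 2 (L2 Ω × L2Vec Ω)

variable {d : ℕ}

/-- `g` is the weak gradient of `w` in `Ω`. -/
def IsWeakGradient (Ω : Opens (Eu d)) (w : L2 Ω) (g : L2Vec Ω) : Prop :=
  ∀ (φ : 𝓓(Ω, ℝ)) (i : Fin d),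
    ∫ x in (Ω : Set (Eu d)), w x * (∇ φ x) i = - ∫ x in (Ω : Set (Eu d)), g x i * φ x

/-- `q` is the weak divergence of the vector field `τ` in `Ω`. -/
def IsWeakDivergence (Ω : Opens (Eu d)) (τ : L2Vec Ω) (q : L2 Ω) : Prop :=
  ∀ φ : 𝓓(Ω, ℝ),
    ∫ x in (Ω : Set (Eu d)), q x * φ x = - ∫ x in (Ω : Set (Eu d)), ⟪τ x, ∇ φ x⟫

/-- The pairs `(φ, ∇φ)` (classes of functions modulo null sets) with `φ ∈ C_c^∞(Ω)`. -/
def testPairs (Ω : Opens (Eu d)) : Submodule ℝ (L2Pair Ω) where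
  carrier := {p | ∃ φ : 𝓓(Ω, ℝ),
    p.fst =ᵐ[volume.restrict (Ω : Set (Eu d))] φ ∧
    p.snd =ᵐ[volume.restrict (Ω : Set (Eu d))] ∇ φ}
  add_mem' := by
    rintro p q ⟨φ, h1, h2⟩ ⟨ψ, h3, h4⟩
    refine ⟨φ + ψ, ?_, ?_⟩
    · filter_upwards [Lp.coeFn_add p.fst q.fst, h1, h3] with x hx h1 h3
      refine hx.trans ?_
      rw [Pi.add_apply, h1, h3, FunLike.coe_add, Pi.add_apply]
    · filter_upwards [Lp.coeFn_add p.snd q.snd, h2, h4] with x hx h2 h4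
      have hφ : DifferentiableAt ℝ φ x := φ.contDiff.differentiable (by simp) x
      have hψ : DifferentiableAt ℝ ψ x := ψ.contDiff.differentiable (by simp) x
      refine hx.trans ?_
      rw [Pi.add_apply, h2, h4]
      simp only [gradient, FunLike.coe_add, fderiv_add hφ hψ, map_add]
  zero_mem' := by
    refine ⟨0, ?_, ?_⟩
    · filter_upwards [Lp.coeFn_zero ℝ 2 (volume.restrict (Ω : Set (Eu d)))] with x hx
      refine hx.trans ?_
      rw [FunLike.coe_zero]
    · filter_upwards [Lp.coeFn_zero (Eu d) 2 (volume.restrict (Ω : Set (Eu d)))] with x hx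
      refine hx.trans ?_
      simp [gradient, FunLike.coe_zero]
  smul_mem' := by
    rintro c p ⟨φ, h1, h2⟩
    refine ⟨c • φ, ?_, ?_⟩
    · filter_upwards [Lp.coeFn_smul c p.fst, h1] with x hx h1
      refine hx.trans ?_
      rw [Pi.smul_apply, h1, FunLike.coe_smul, Pi.smul_apply]
    · filter_upwards [Lp.coeFn_smul c p.snd, h2] with x hx h2
      have hφ : DifferentiableAt ℝ φ x := φ.contDiff.differentiable (by simp) x
      refine hx.trans ?_
      rw [Pi.smul_apply, h2]
      simp only [gradient, FunLike.coe_smul, fderiv_const_smul hφ, map_smul]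

/-- `V = H¹₀(Ω)`: the closure of `C_c^∞(Ω)` in the `H¹`-norm. A function `w ∈ H¹₀(Ω)` is
represented by the pair `(w, ∇w)`. -/
def H10 (Ω : Opens (Eu d)) : Submodule ℝ (L2Pair Ω) := (testPairs Ω).topologicalClosure

/-- The element `w` of `L²(Ω)` underlying `w ∈ H¹₀(Ω)`. -/
def fn {Ω : Opens (Eu d)} (w : H10 Ω) : L2 Ω := (w : L2Pair Ω).fst

/-- The gradient `∇w ∈ [L²(Ω)]ᵈ` of `w ∈ H¹₀(Ω)`. -/
def grad {Ω : Opens (Eu d)} (w : H10 Ω) : L2Vec Ω := (w : L2Pair Ω).snd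

theorem hasCompactSupport_gradient (Ω : Opens (Eu d)) (φ : 𝓓(Ω, ℝ)) :
    HasCompactSupport (∇ φ : Eu d → Eu d) :=
  (φ.hasCompactSupport.fderiv ℝ).comp_left
    (g := (InnerProductSpace.toDual ℝ (Eu d)).symm) (map_zero _)

theorem continuous_gradient (Ω : Opens (Eu d)) (φ : 𝓓(Ω, ℝ)) :
    Continuous (∇ φ : Eu d → Eu d) :=
  (LinearIsometryEquiv.continuous _).comp (φ.contDiff.continuous_fderiv (by simp))

theorem gradient_apply (Ω : Opens (Eu d)) (φ : 𝓓(Ω, ℝ)) (x : Eu d) (i : Fin d) :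
    (∇ φ x) i = fderiv ℝ φ x (EuclideanSpace.single i 1) := by
  have h : ⟪∇ φ x, EuclideanSpace.single i (1 : ℝ)⟫ = fderiv ℝ φ x (EuclideanSpace.single i 1) := by
    simp [gradient]
  rw [← h, EuclideanSpace.inner_single_right]
  simp

theorem integral_mul_gradient (Ω : Opens (Eu d)) (φ ψ : 𝓓(Ω, ℝ)) (i : Fin d) :
    ∫ x in (Ω : Set (Eu d)), φ x * (∇ ψ x) i = - ∫ x in (Ω : Set (Eu d)), (∇ φ x) i * ψ x := by
  have hc : ∀ χ : 𝓓(Ω, ℝ), Continuous fun x => (∇ χ x : Eu d) i := fun χ =>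
    (EuclideanSpace.proj i).continuous.comp (continuous_gradient Ω χ)
  have hz : ∀ (χ : 𝓓(Ω, ℝ)) (x : Eu d), x ∉ (Ω : Set (Eu d)) → χ x = 0 := fun χ x hx =>
    image_eq_zero_of_notMem_tsupport fun h => hx (χ.tsupport_subset h)
  rw [setIntegral_eq_integral_of_forall_compl_eq_zero fun x hx => by simp [hz φ x hx],
    setIntegral_eq_integral_of_forall_compl_eq_zero fun x hx => by simp [hz ψ x hx]]
  simp only [gradient_apply] at hc ⊢
  refine integral_mul_fderiv_eq_neg_fderiv_mul_of_integrable ?_ ?_ ?_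
    (fun x _ => φ.contDiff.differentiable (by simp) x)
    (fun x _ => ψ.contDiff.differentiable (by simp) x)
  · exact ((hc φ).mul ψ.continuous).integrable_of_hasCompactSupport ψ.hasCompactSupport.mul_left
  · exact (φ.continuous.mul (hc ψ)).integrable_of_hasCompactSupport φ.hasCompactSupport.mul_right
  · exact (φ.continuous.mul ψ.continuous).integrable_of_hasCompactSupport
      φ.hasCompactSupport.mul_right

/-- The second component of an element of `H¹₀(Ω)` is the weak gradient of the first one. -/
theorem isWeakGradient_grad {Ω : Opens (Eu d)} (w : H10 Ω) :
    IsWeakGradient Ω (fn w) (grad w) := by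
  intro φ i
  have ha : MemLp (fun x => (∇ φ x : Eu d) i) 2 (volume.restrict (Ω : Set (Eu d))) :=
    (((EuclideanSpace.proj i).continuous.comp (continuous_gradient Ω φ) :
      Continuous fun x => (∇ φ x : Eu d) i).memLp_of_hasCompactSupport
      ((hasCompactSupport_gradient Ω φ).comp_left (g := fun v : Eu d => v i) rfl)).restrict _
  have hb : MemLp (fun x => φ x • (EuclideanSpace.single i (1 : ℝ) : Eu d)) 2
      (volume.restrict (Ω : Set (Eu d))) :=
    ((φ.continuous.smul continuous_const).memLp_of_hasCompactSupport
      φ.hasCompactSupport.smul_right).restrict _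
  have h1 : ∀ p : L2Pair Ω, ∫ x in (Ω : Set (Eu d)), p.fst x * (∇ φ x) i
      = ⟪p.fst, ha.toLp _⟫ := fun p => by
    rw [L2.inner_def]
    refine integral_congr_ae ?_
    filter_upwards [ha.coeFn_toLp] with x hx
    rw [hx]; simp [mul_comm]
  have h2 : ∀ p : L2Pair Ω, ∫ x in (Ω : Set (Eu d)), p.snd x i * φ x
      = ⟪p.snd, hb.toLp _⟫ := fun p => by
    rw [L2.inner_def]
    refine integral_congr_ae ?_
    filter_upwards [hb.coeFn_toLp] with x hx
    rw [hx, inner_smul_right, EuclideanSpace.inner_single_right]; simp [mul_comm]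
  have hcl : IsClosed {p : L2Pair Ω | ⟪p.fst, ha.toLp _⟫ = - ⟪p.snd, hb.toLp _⟫} :=
    isClosed_eq (by fun_prop) (by fun_prop)
  have hsub : (testPairs Ω : Set (L2Pair Ω)) ⊆
      {p : L2Pair Ω | ⟪p.fst, ha.toLp _⟫ = - ⟪p.snd, hb.toLp _⟫} := by
    rintro p ⟨ψ, hp1, hp2⟩
    rw [Set.mem_ofPred_eq, ← h1, ← h2]
    have e1 : ∫ x in (Ω : Set (Eu d)), p.fst x * (∇ φ x) i
        = ∫ x in (Ω : Set (Eu d)), ψ x * (∇ φ x) i := by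
      refine integral_congr_ae ?_
      filter_upwards [hp1] with x hx
      rw [hx]
    have e2 : ∫ x in (Ω : Set (Eu d)), p.snd x i * φ x
        = ∫ x in (Ω : Set (Eu d)), (∇ ψ x) i * φ x := by
      refine integral_congr_ae ?_
      filter_upwards [hp2] with x hx
      rw [hx]
    rw [e1, e2, integral_mul_gradient]
  have hw := closure_minimal hsub hcl w.2
  rw [Set.mem_ofPred_eq, ← h1, ← h2] at hw
  exact hw

/-- `C` is a constant for the Friedrichs inequality `‖w‖ ≤ C ‖∇w‖` on `H¹₀(Ω)`. -/
def IsFriedrichsConstant (Ω : Opens (Eu d)) (C : ℝ) : Prop :=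
  0 < C ∧ ∀ w : H10 Ω, ‖fn w‖ ≤ C * ‖grad w‖

/-- The Friedrichs inequality for test functions. -/
theorem integral_sq_le_testFunction {Ω : Opens (Eu d)} (i : Fin d) {R : ℝ} (hR : 0 < R)
    (hΩR : ∀ x ∈ (Ω : Set (Eu d)), ‖x‖ ≤ R) (φ : 𝓓(Ω, ℝ)) :
    ∫ x in (Ω : Set (Eu d)), φ x ^ 2
      ≤ 4 * R ^ 2 * ∫ x in (Ω : Set (Eu d)), ‖(∇ φ x : Eu d)‖ ^ 2 := by
  have hcg := continuous_gradient Ω φ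
  have c2 : HasCompactSupport fun x => φ x ^ 2 := by
    simp only [pow_two]
    exact φ.hasCompactSupport.mul_left
  have c3 : HasCompactSupport fun x => ‖(∇ φ x : Eu d)‖ ^ 2 := by
    simp only [pow_two]
    exact (hasCompactSupport_gradient Ω φ).norm.mul_left
  have i1 : Integrable (fun x => φ x ^ 2) (volume.restrict (Ω : Set (Eu d))) :=
    ((φ.continuous.pow 2).integrable_of_hasCompactSupport c2).restrict
  have i2 : Integrable (fun x => ‖(∇ φ x : Eu d)‖ ^ 2) (volume.restrict (Ω : Set (Eu d))) :=
    ((hcg.norm.pow 2).integrable_of_hasCompactSupport c3).restrict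
  have hcx : Continuous fun x : Eu d => x i := (EuclideanSpace.proj i).continuous
  have hcφ : Continuous fun x => fderiv ℝ φ x (EuclideanSpace.single i (1 : ℝ)) := by
    have h : Continuous fun x => (∇ φ x : Eu d) i := (EuclideanSpace.proj i).continuous.comp hcg
    simpa only [gradient_apply] using h
  have hdφ : ∀ x, DifferentiableAt ℝ φ x := fun x => φ.contDiff.differentiable (by simp) x
  have hf2 : ∀ x, fderiv ℝ (fun y => φ y ^ 2) x (EuclideanSpace.single i (1 : ℝ))
      = 2 * φ x * fderiv ℝ φ x (EuclideanSpace.single i 1) := fun x => by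
    rw [fderiv_fun_pow 2 (hdφ x)]
    simp
  have hfx : ∀ x, fderiv ℝ (fun y : Eu d => y i) x (EuclideanSpace.single i (1 : ℝ)) = 1 := fun x => by
    have : HasFDerivAt (fun y : Eu d => y i) (EuclideanSpace.proj i : Eu d →L[ℝ] ℝ) x :=
      (EuclideanSpace.proj i : Eu d →L[ℝ] ℝ).hasFDerivAt
    rw [this.fderiv]
    simp
  have hint := integral_mul_fderiv_eq_neg_fderiv_mul_of_integrable (μ := (volume : Measure (Eu d)))
    (f := fun x : Eu d => x i) (g := fun x => φ x ^ 2) (v := EuclideanSpace.single i (1 : ℝ))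
    (by
      simp only [hfx, one_mul]
      exact (φ.continuous.pow 2).integrable_of_hasCompactSupport c2)
    (by
      simp only [hf2]
      exact (hcx.mul ((continuous_const.mul φ.continuous).mul hcφ)).integrable_of_hasCompactSupport
        φ.hasCompactSupport.mul_left.mul_right.mul_left)
    ((hcx.mul (φ.continuous.pow 2)).integrable_of_hasCompactSupport c2.mul_left)
    (fun x _ => (EuclideanSpace.proj i : Eu d →L[ℝ] ℝ).differentiableAt)
    (fun x _ => (hdφ x).pow 2)
  simp only [hfx, hf2, one_mul] at hint
  have hz : ∀ x : Eu d, x ∉ (Ω : Set (Eu d)) → φ x = 0 := fun x hx =>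
    image_eq_zero_of_notMem_tsupport fun h => hx (φ.tsupport_subset h)
  rw [← setIntegral_eq_integral_of_forall_compl_eq_zero
      (s := (Ω : Set (Eu d))) fun x hx => by simp [hz x hx],
    ← setIntegral_eq_integral_of_forall_compl_eq_zero
      (s := (Ω : Set (Eu d))) (f := fun x => φ x ^ 2) fun x hx => by simp [hz x hx]] at hint
  have hle : ∫ x in (Ω : Set (Eu d)), φ x ^ 2
      ≤ ∫ x in (Ω : Set (Eu d)), (1 / 2 * φ x ^ 2 + 2 * R ^ 2 * ‖(∇ φ x : Eu d)‖ ^ 2) := by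
    have : ∫ x in (Ω : Set (Eu d)), φ x ^ 2 = ∫ x in (Ω : Set (Eu d)),
        -(x i * (2 * φ x * fderiv ℝ φ x (EuclideanSpace.single i 1))) := by
      rw [integral_neg, hint, neg_neg]
    rw [this]
    refine setIntegral_mono_on ?_ ((i1.const_mul _).add (i2.const_mul _))
      Ω.isOpen.measurableSet ?_
    · exact (((hcx.mul ((continuous_const.mul φ.continuous).mul
        hcφ)).integrable_of_hasCompactSupport
          φ.hasCompactSupport.mul_left.mul_right.mul_left).neg).restrict
    · intro x hx
      have b1 : |x i| ≤ R := by
        simpa using (PiLp.norm_apply_le x i).trans (hΩR x hx)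
      have b2 : |(∇ φ x : Eu d) i| ≤ ‖(∇ φ x : Eu d)‖ := by
        simpa using PiLp.norm_apply_le (∇ φ x : Eu d) i
      rw [← gradient_apply]
      have b3 : |x i * (∇ φ x : Eu d) i| ≤ R * ‖(∇ φ x : Eu d)‖ := by
        rw [abs_mul]
        exact mul_le_mul b1 b2 (abs_nonneg _) hR.le
      have b4 : (x i * (∇ φ x : Eu d) i) ^ 2 ≤ (R * ‖(∇ φ x : Eu d)‖) ^ 2 :=
        sq_le_sq' (abs_le.1 b3).1 (abs_le.1 b3).2
      nlinarith [sq_nonneg (φ x + 2 * (x i * (∇ φ x : Eu d) i))]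
  rw [integral_add (i1.const_mul _) (i2.const_mul _), integral_const_mul,
    integral_const_mul] at hle
  linarith

/-- On a bounded open set there is such a constant. -/
theorem exists_isFriedrichsConstant {Ω : Opens (Eu d)} (hd : 0 < d)
    (hΩ : Bornology.IsBounded (Ω : Set (Eu d))) :
    ∃ C : ℝ, IsFriedrichsConstant Ω C := by
  obtain ⟨R, hR, hΩR⟩ := hΩ.exists_pos_norm_le
  refine ⟨2 * R, by positivity, fun w => ?_⟩
  have hcl : IsClosed {p : L2Pair Ω | ‖p.fst‖ ≤ 2 * R * ‖p.snd‖} :=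
    isClosed_le (by fun_prop) (by fun_prop)
  refine closure_minimal ?_ hcl w.2
  rintro p ⟨φ, hp1, hp2⟩
  rw [Set.mem_ofPred_eq]
  refine (sq_le_sq₀ (norm_nonneg _) (by positivity)).1 ?_
  have n1 : ‖p.fst‖ ^ 2 = ∫ x in (Ω : Set (Eu d)), φ x ^ 2 := by
    rw [← real_inner_self_eq_norm_sq, L2.inner_def]
    refine integral_congr_ae ?_
    filter_upwards [hp1] with x hx
    rw [hx, real_inner_self_eq_norm_sq, Real.norm_eq_abs, sq_abs]
  have n2 : ‖p.snd‖ ^ 2 = ∫ x in (Ω : Set (Eu d)), ‖(∇ φ x : Eu d)‖ ^ 2 := by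
    rw [← real_inner_self_eq_norm_sq, L2.inner_def]
    refine integral_congr_ae ?_
    filter_upwards [hp2] with x hx
    rw [hx, real_inner_self_eq_norm_sq]
  have h := integral_sq_le_testFunction ⟨0, hd⟩ hR hΩR φ
  rw [← n1, ← n2] at h
  calc ‖p.fst‖ ^ 2 ≤ 4 * R ^ 2 * ‖p.snd‖ ^ 2 := h
    _ = (2 * R * ‖p.snd‖) ^ 2 := by ring

/-- `H(div, Ω)`: a field `τ ∈ [L²(Ω)]ᵈ` together with its weak divergence `div τ ∈ L²(Ω)`. -/
structure HDiv (Ω : Opens (Eu d)) where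
  field : L2Vec Ω
  div : L2 Ω
  isWeakDivergence : IsWeakDivergence Ω field div

/-- Data of the optimal control problem: minimize `½‖y - y_d‖² + (lam/2)‖v - u_d‖²` over
`y ∈ H¹₀(Ω)` and `v ∈ L²(Ω)` with `u_a ≤ v ≤ u_b` a.e., subject to
`-div(ν ∇y) = f + v` in `Ω`, `y = 0` on the boundary. -/
structure ControlProblem (d : ℕ) where
  Ω : Opens (Eu d)
  isBounded : Bornology.IsBounded (Ω : Set (Eu d))
  y_d : L2 Ω
  u_d : L2 Ω
  f : L2 Ω
  lam : ℝ
  lam_pos : 0 < lam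
  u_a : L2 Ω
  u_b : L2 Ω
  u_a_le_u_b : ∀ᵐ x ∂(volume.restrict (Ω : Set (Eu d))), u_a x ≤ u_b x
  ν : Eu d → ℝ
  ν_lo : ℝ
  ν_hi : ℝ
  ν_measurable : AEMeasurable ν (volume.restrict (Ω : Set (Eu d)))
  ν_lo_pos : 0 < ν_lo
  ν_lo_le : ∀ x ∈ Ω, ν_lo ≤ ν x
  ν_le_hi : ∀ x ∈ Ω, ν x ≤ ν_hi

namespace ControlProblem

variable (P : ControlProblem d)

theorem memLp_flux (g : L2Vec P.Ω) :
    MemLp (fun x => P.ν x • g x) 2 (volume.restrict (P.Ω : Set (Eu d))) := by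
  refine (Lp.memLp g).of_le_mul (c := P.ν_hi)
    (P.ν_measurable.aestronglyMeasurable.smul (Lp.aestronglyMeasurable g)) ?_
  filter_upwards [ae_restrict_mem P.Ω.isOpen.measurableSet] with x hx
  rw [norm_smul, Real.norm_of_nonneg (P.ν_lo_pos.le.trans (P.ν_lo_le x hx))]
  exact mul_le_mul_of_nonneg_right (P.ν_le_hi x hx) (norm_nonneg _)

/-- The field `ν g ∈ [L²(Ω)]ᵈ` for `g ∈ [L²(Ω)]ᵈ`. -/
def flux (g : L2Vec P.Ω) : L2Vec P.Ω := (P.memLp_flux g).toLp _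

/-- The admissible controls. -/
def Uad : Set (L2 P.Ω) :=
  {v | ∀ᵐ x ∂(volume.restrict (P.Ω : Set (Eu d))), P.u_a x ≤ v x ∧ v x ≤ P.u_b x}

/-- `y ∈ H¹₀(Ω)` is the state `y(v)`, the weak solution of the boundary value problem with
control `v`: `∫ ν ∇y · ∇w = ∫ (f + v) w` for all `w ∈ H¹₀(Ω)`. -/
def IsState (v : L2 P.Ω) (y : H10 P.Ω) : Prop :=
  ∀ w : H10 P.Ω, ⟪P.flux (grad y), grad w⟫ = ⟪P.f + v, fn w⟫

/-- The cost functional. -/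
def cost (y : H10 P.Ω) (v : L2 P.Ω) : ℝ :=
  1 / 2 * ‖fn y - P.y_d‖ ^ 2 + P.lam / 2 * ‖v - P.u_d‖ ^ 2

/-- `u` is an optimal control and `y` is its state `y(u)`. -/
def IsOptimal (y : H10 P.Ω) (u : L2 P.Ω) : Prop :=
  u ∈ P.Uad ∧ P.IsState u y ∧
    ∀ (y' : H10 P.Ω) (v : L2 P.Ω), v ∈ P.Uad → P.IsState v y' → P.cost y u ≤ P.cost y' v

/-- The control `v_ζ = min {u_b, max {u_a, u_d - ζ / lam}}`. -/
def projControl (ζ : H10 P.Ω) : L2 P.Ω :=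
  P.u_b ⊓ (P.u_a ⊔ (P.u_d - (1 / P.lam) • fn ζ))

theorem projControl_ae (ζ : H10 P.Ω) :
    ∀ᵐ x ∂(volume.restrict (P.Ω : Set (Eu d))), P.projControl ζ x
      = min (P.u_b x) (max (P.u_a x) (P.u_d x - 1 / P.lam * fn ζ x)) := by
  filter_upwards [Lp.coeFn_inf P.u_b (P.u_a ⊔ (P.u_d - (1 / P.lam) • fn ζ)),
    Lp.coeFn_sup P.u_a (P.u_d - (1 / P.lam) • fn ζ),
    Lp.coeFn_sub P.u_d ((1 / P.lam) • fn ζ),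
    Lp.coeFn_smul (1 / P.lam) (fn ζ)] with x h1 h2 h3 h4
  refine h1.trans ?_
  rw [Pi.inf_apply, h2, Pi.sup_apply, h3, Pi.sub_apply, h4]
  rfl

/-- The squared combined norm of the error between `(y, u)` and `(y', v)`, where `y = y(u)` and
`y' = y(v)`. -/
def combinedNormSq (y y' : H10 P.Ω) (u v : L2 P.Ω) : ℝ :=
  1 / 2 * ‖fn y - fn y'‖ ^ 2 + P.lam / 2 * ‖u - v‖ ^ 2

/-- The majorant of the cost functional. -/
def costMajorant (C α β : ℝ) (η : H10 P.Ω) (τ : HDiv P.Ω) (v : L2 P.Ω) : ℝ :=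
  (1 + α) / 2 * ‖fn η - P.y_d‖ ^ 2
    + (1 + α) * (1 + β) * C ^ 2 / (2 * α * P.ν_lo ^ 2) * ‖τ.field - P.flux (grad η)‖ ^ 2
    + (1 + α) * (1 + β) * C ^ 4 / (2 * α * β * P.ν_lo ^ 2) * ‖P.f + v + τ.div‖ ^ 2
    + P.lam / 2 * ‖v - P.u_d‖ ^ 2

/-- The minorant of the cost functional; `v` stands for `v_ζ`. -/
def costMinorant (C : ℝ) (η ζ : H10 P.Ω) (τ ρ : HDiv P.Ω) (v : L2 P.Ω) : ℝ :=
  1 / 2 * ‖fn η - P.y_d‖ ^ 2 + P.lam / 2 * ‖v - P.u_d‖ ^ 2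
    + ⟪P.f + v + τ.div, fn ζ⟫ + ⟪τ.field - P.flux (grad η), grad ζ⟫
    - 1 / P.ν_lo * (C * ‖fn η - P.y_d + ρ.div‖ + ‖ρ.field - P.flux (grad ζ)‖)
      * (C ^ 3 / (P.lam * P.ν_lo) * ‖fn η - P.y_d + ρ.div‖
        + C ^ 2 / (P.lam * P.ν_lo) * ‖ρ.field - P.flux (grad ζ)‖
        + C * ‖P.f + v + τ.div‖ + ‖τ.field - P.flux (grad η)‖)

/-- The error majorant, in explicit form; `v` stands for `v_ζ`. -/
def errorMajorant (C α β : ℝ) (η ζ : H10 P.Ω) (τ ρ : HDiv P.Ω) (v : L2 P.Ω) : ℝ :=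
  α / 2 * ‖fn η - P.y_d‖ ^ 2
    + (1 + α) * (1 + β) * C ^ 2 / (2 * α * P.ν_lo ^ 2) * ‖τ.field - P.flux (grad η)‖ ^ 2
    + (1 + α) * (1 + β) * C ^ 4 / (2 * α * β * P.ν_lo ^ 2) * ‖P.f + v + τ.div‖ ^ 2
    - ⟪P.f + v + τ.div, fn ζ⟫ - ⟪τ.field - P.flux (grad η), grad ζ⟫
    + 1 / P.ν_lo * (C * ‖fn η - P.y_d + ρ.div‖ + ‖ρ.field - P.flux (grad ζ)‖)
      * (C ^ 3 / (P.lam * P.ν_lo) * ‖fn η - P.y_d + ρ.div‖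
        + C ^ 2 / (P.lam * P.ν_lo) * ‖ρ.field - P.flux (grad ζ)‖
        + C * ‖P.f + v + τ.div‖ + ‖τ.field - P.flux (grad η)‖)

end ControlProblem

end EllipticControl

end

open MeasureTheory TopologicalSpace
open scoped Distributions Gradient RealInnerProductSpace ENNReal

namespace EllipticControl

variable {d : ℕ}

/-! The cost is quadratic and the control-to-state relation is affine. Hence along the segment from
the optimal pair to `(y(v), v)` the cost is a quadratic polynomial whose leading coefficient is
exactly `|||u - v|||²`, and whose linear coefficient is nonnegative by optimality. At the end of the
segment this gives `|||u - v|||² ≤ J(y(v), v) - J(y(u), u)` (`IsOptimal.combinedNormSq_le`).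

It remains to bound the two costs by computable quantities. Both bounds rest on the residual
estimate `IsState.norm_grad_sub_le`. Above (`cost_le_costMajorant`): the triangle inequality through
`η`, the Friedrichs inequality, and Young's inequality twice. Below (`costMinorant_le_cost`): an
exact expansion of the cost about `(η, v_ζ)`, with `ζ` in the role of an adjoint state. The
projection inequality for `v_ζ` discards one term. The residual at the unknown `u` differs from the
one at `v_ζ` by at most `‖u - v_ζ‖`, which the control term `λ/2 ‖u - v_ζ‖²` absorbs. -/

@[simp]
theorem fn_add {Ω : Opens (Eu d)} (v w : H10 Ω) : fn (v + w) = fn v + fn w := rfl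

@[simp]
theorem fn_sub {Ω : Opens (Eu d)} (v w : H10 Ω) : fn (v - w) = fn v - fn w := rfl

@[simp]
theorem fn_smul {Ω : Opens (Eu d)} (c : ℝ) (w : H10 Ω) : fn (c • w) = c • fn w := rfl

@[simp]
theorem grad_add {Ω : Opens (Eu d)} (v w : H10 Ω) : grad (v + w) = grad v + grad w := rfl

@[simp]
theorem grad_sub {Ω : Opens (Eu d)} (v w : H10 Ω) : grad (v - w) = grad v - grad w := rfl

@[simp]
theorem grad_smul {Ω : Opens (Eu d)} (c : ℝ) (w : H10 Ω) : grad (c • w) = c • grad w := rfl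

/-- Integration by parts: test functions in the definition of the weak divergence can be replaced
by elements of `H¹₀(Ω)`. -/
theorem HDiv.inner_div {Ω : Opens (Eu d)} (τ : HDiv Ω) (w : H10 Ω) :
    ⟪τ.div, fn w⟫ = - ⟪τ.field, grad w⟫ := by
  -- Both sides are continuous in the pair, so it suffices to check test pairs, where this is the
  -- definition of the weak divergence.
  have hcl : IsClosed {p : L2Pair Ω | ⟪τ.div, p.fst⟫ = - ⟪τ.field, p.snd⟫} :=
    isClosed_eq (by fun_prop) (by fun_prop)
  refine closure_minimal ?_ hcl w.2
  rintro p ⟨φ, h1, h2⟩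
  rw [Set.mem_ofPred_eq, L2.inner_def, L2.inner_def]
  have e1 : ∫ x in (Ω : Set (Eu d)), ⟪τ.div x, p.fst x⟫
      = ∫ x in (Ω : Set (Eu d)), τ.div x * φ x := by
    refine integral_congr_ae ?_
    filter_upwards [h1] with x hx
    rw [hx]; simp [mul_comm]
  have e2 : ∫ x in (Ω : Set (Eu d)), ⟪τ.field x, p.snd x⟫
      = ∫ x in (Ω : Set (Eu d)), ⟪τ.field x, ∇ φ x⟫ := by
    refine integral_congr_ae ?_
    filter_upwards [h2] with x hx
    rw [hx]
  rw [e1, e2, τ.isWeakDivergence φ]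

namespace ControlProblem

variable (P : ControlProblem d)

/-! ### The flux as a symmetric coercive operator -/

theorem flux_coeFn (g : L2Vec P.Ω) :
    P.flux g =ᵐ[volume.restrict (P.Ω : Set (Eu d))] fun x => P.ν x • g x :=
  (P.memLp_flux g).coeFn_toLp

theorem flux_add (g h : L2Vec P.Ω) : P.flux (g + h) = P.flux g + P.flux h := by
  refine Lp.ext ?_
  filter_upwards [P.flux_coeFn (g + h), P.flux_coeFn g, P.flux_coeFn h, Lp.coeFn_add g h,
    Lp.coeFn_add (P.flux g) (P.flux h)] with x h1 h2 h3 h4 h5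
  rw [h1, h5, h4, Pi.add_apply, Pi.add_apply, h2, h3, smul_add]

theorem flux_smul (c : ℝ) (g : L2Vec P.Ω) : P.flux (c • g) = c • P.flux g := by
  refine Lp.ext ?_
  filter_upwards [P.flux_coeFn (c • g), P.flux_coeFn g, Lp.coeFn_smul c g,
    Lp.coeFn_smul c (P.flux g)] with x h1 h2 h3 h4
  rw [h1, h4, h3, Pi.smul_apply, Pi.smul_apply, h2, smul_comm]

theorem flux_sub (g h : L2Vec P.Ω) : P.flux (g - h) = P.flux g - P.flux h := by
  rw [eq_sub_iff_add_eq, ← flux_add, sub_add_cancel]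

theorem inner_flux_comm (g h : L2Vec P.Ω) : ⟪P.flux g, h⟫ = ⟪P.flux h, g⟫ := by
  rw [L2.inner_def, L2.inner_def]
  refine integral_congr_ae ?_
  filter_upwards [P.flux_coeFn g, P.flux_coeFn h] with x h1 h2
  rw [h1, h2, real_inner_smul_left, real_inner_smul_left, real_inner_comm]

theorem le_inner_flux_self (g : L2Vec P.Ω) : P.ν_lo * ‖g‖ ^ 2 ≤ ⟪P.flux g, g⟫ := by
  rw [← real_inner_self_eq_norm_sq, ← real_inner_smul_left, L2.inner_def, L2.inner_def]
  refine integral_mono_ae (L2.integrable_inner _ _) (L2.integrable_inner _ _) ?_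
  filter_upwards [P.flux_coeFn g, Lp.coeFn_smul P.ν_lo g,
    ae_restrict_mem P.Ω.isOpen.measurableSet] with x h1 h2 hx
  rw [h1, h2, Pi.smul_apply, real_inner_smul_left, real_inner_smul_left]
  exact mul_le_mul_of_nonneg_right (P.ν_lo_le x hx) real_inner_self_nonneg

variable {P}

/-! ### The projected control -/

theorem projControl_mem_Uad (ζ : H10 P.Ω) : P.projControl ζ ∈ P.Uad := by
  filter_upwards [P.projControl_ae ζ, P.u_a_le_u_b] with x h1 h2
  rw [h1]
  exact ⟨le_min h2 (le_max_left _ _), min_le_left _ _⟩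

/-- The variational inequality that characterizes the projection `v_ζ`. -/
theorem projControl_variational_inequality (ζ : H10 P.Ω) {u : L2 P.Ω} (hu : u ∈ P.Uad) :
    0 ≤ ⟪P.lam • (P.projControl ζ - P.u_d) + fn ζ, u - P.projControl ζ⟫ := by
  rw [L2.inner_def]
  refine integral_nonneg_of_ae ?_
  filter_upwards [P.projControl_ae ζ, P.u_a_le_u_b, hu, Lp.coeFn_sub u (P.projControl ζ),
    Lp.coeFn_add (P.lam • (P.projControl ζ - P.u_d)) (fn ζ),
    Lp.coeFn_smul P.lam (P.projControl ζ - P.u_d),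
    Lp.coeFn_sub (P.projControl ζ) P.u_d] with x h1 h2 h3 h4 h5 h6 h7
  rw [h4, h5, Pi.add_apply, h6, Pi.smul_apply, h7, Pi.sub_apply, Pi.sub_apply]
  have hl := P.lam_pos
  have hz : fn ζ x = P.lam * (1 / P.lam * fn ζ x) := by field_simp
  generalize 1 / P.lam * fn ζ x = z at h1 hz
  -- With `λ` divided out, this is the variational inequality of the projection onto `[u_a, u_b]`:
  -- the factors have equal signs where a bound is active, and the second vanishes elsewhere.
  have key : 0 ≤ (u x - P.projControl ζ x) * (P.projControl ζ x - P.u_d x + z) := by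
    rcases le_total (P.u_a x) (P.u_d x - z) with ha | ha
    · rw [max_eq_right ha] at h1
      rcases le_total (P.u_b x) (P.u_d x - z) with hb | hb
      · rw [min_eq_left hb] at h1
        rw [h1]
        exact mul_nonneg_of_nonpos_of_nonpos (by linarith) (by linarith)
      · rw [min_eq_right hb] at h1
        simp [h1]
    · rw [max_eq_left ha, min_eq_right h2] at h1
      rw [h1]
      exact mul_nonneg (by linarith) (by linarith)
  rw [hz]
  simp only [Pi.zero_apply, smul_eq_mul, RCLike.inner_apply, conj_trivial]
  nlinarith [mul_nonneg hl.le key]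

/-! ### The cost along segments and optimality -/

theorem IsState.add_smul_sub {u v : L2 P.Ω} {y z : H10 P.Ω} (hy : P.IsState u y)
    (hz : P.IsState v z) (t : ℝ) : P.IsState (u + t • (v - u)) (y + t • (z - y)) := by
  intro w
  have h1 := hy w
  have h2 := hz w
  simp only [grad_add, grad_smul, grad_sub, flux_add, flux_smul, flux_sub, inner_add_left,
    inner_sub_left, real_inner_smul_left] at h1 h2 ⊢
  linear_combination (1 - t) * h1 + t * h2

theorem add_smul_sub_mem_Uad {u v : L2 P.Ω} (hu : u ∈ P.Uad) (hv : v ∈ P.Uad) {t : ℝ}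
    (h0 : 0 ≤ t) (h1 : t ≤ 1) : u + t • (v - u) ∈ P.Uad := by
  filter_upwards [hu, hv, Lp.coeFn_add u (t • (v - u)), Lp.coeFn_smul t (v - u),
    Lp.coeFn_sub v u] with x hu hv e1 e2 e3
  rw [e1, Pi.add_apply, e2, Pi.smul_apply, e3, Pi.sub_apply, smul_eq_mul]
  constructor <;> nlinarith [mul_le_mul_of_nonneg_left hu.1 (sub_nonneg.2 h1),
    mul_le_mul_of_nonneg_left hv.1 h0, mul_le_mul_of_nonneg_left hu.2 (sub_nonneg.2 h1),
    mul_le_mul_of_nonneg_left hv.2 h0]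

theorem cost_add_smul_sub (y z : H10 P.Ω) (u v : L2 P.Ω) (t : ℝ) :
    P.cost (y + t • (z - y)) (u + t • (v - u)) = P.cost y u
      + t * (⟪fn y - P.y_d, fn z - fn y⟫ + P.lam * ⟪u - P.u_d, v - u⟫)
      + t ^ 2 * P.combinedNormSq y z u v := by
  have e1 : fn (y + t • (z - y)) - P.y_d = (fn y - P.y_d) + t • (fn z - fn y) := by
    simp only [fn_add, fn_smul, fn_sub]; abel
  have e2 : u + t • (v - u) - P.u_d = (u - P.u_d) + t • (v - u) := by abel
  rw [cost, cost, combinedNormSq, e1, e2, norm_add_sq_real, norm_add_sq_real,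
    real_inner_smul_right, real_inner_smul_right, norm_smul, norm_smul, mul_pow, mul_pow,
    Real.norm_eq_abs, sq_abs, norm_sub_rev (fn y) (fn z), norm_sub_rev u v]
  ring

/-- The variational inequality for the optimal control. -/
theorem IsOptimal.variational_inequality {y z : H10 P.Ω} {u v : L2 P.Ω} (h : P.IsOptimal y u)
    (hv : v ∈ P.Uad) (hz : P.IsState v z) :
    0 ≤ ⟪fn y - P.y_d, fn z - fn y⟫ + P.lam * ⟪u - P.u_d, v - u⟫ := by
  by_contra! hneg
  set D := ⟪fn y - P.y_d, fn z - fn y⟫ + P.lam * ⟪u - P.u_d, v - u⟫ with hD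
  set Q := P.combinedNormSq y z u v with hQ
  have hl := P.lam_pos
  have hQ0 : 0 ≤ Q := by rw [hQ, combinedNormSq]; positivity
  have hpos : 0 < Q - D := by linarith
  -- This step length `t` satisfies `t Q + D = t D`, so the cost changes by `t² D < 0`. It lies in
  -- `(0, 1]` even when `Q = 0`.
  have ht0 : 0 < -D / (Q - D) := div_pos (by linarith) hpos
  have ht1 : -D / (Q - D) ≤ 1 := (div_le_one hpos).2 (by linarith)
  -- The state of the intermediate control is the affine combination of the given states, so
  -- solvability of the state equation is not needed.
  have hmin := h.2.2 _ _ (add_smul_sub_mem_Uad h.1 hv ht0.le ht1)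
    (h.2.1.add_smul_sub hz (-D / (Q - D)))
  rw [cost_add_smul_sub, ← hD, ← hQ] at hmin
  have ht : -D / (Q - D) * (Q - D) = -D := div_mul_cancel₀ _ hpos.ne'
  generalize -D / (Q - D) = t at *
  have : t * (t * D) < 0 := mul_neg_of_pos_of_neg ht0 (mul_neg_of_pos_of_neg ht0 hneg)
  have : t * (t * Q) + t * D = t * (t * D) := by linear_combination t * ht
  linarith

theorem IsOptimal.combinedNormSq_le {y z : H10 P.Ω} {u v : L2 P.Ω} (h : P.IsOptimal y u)
    (hv : v ∈ P.Uad) (hz : P.IsState v z) :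
    P.combinedNormSq y z u v ≤ P.cost z v - P.cost y u := by
  have h1 := cost_add_smul_sub y z u v 1
  have h2 := h.variational_inequality hv hz
  rw [one_smul, one_smul, add_sub_cancel, add_sub_cancel] at h1
  linarith

/-! ### Computable bounds for the state and the cost -/

/-- Functional a posteriori estimate for the state equation. -/
theorem IsState.norm_grad_sub_le {v : L2 P.Ω} {y : H10 P.Ω} (hy : P.IsState v y) {C : ℝ}
    (hC : IsFriedrichsConstant P.Ω C) (η : H10 P.Ω) (τ : HDiv P.Ω) :
    P.ν_lo * ‖grad (y - η)‖
      ≤ C * ‖P.f + v + τ.div‖ + ‖τ.field - P.flux (grad η)‖ := by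
  rcases (norm_nonneg (grad (y - η))).eq_or_lt with h0 | h0
  · rw [← h0, mul_zero]
    exact add_nonneg (mul_nonneg hC.1.le (norm_nonneg _)) (norm_nonneg _)
  refine le_of_mul_le_mul_right ?_ h0
  have h1 := P.le_inner_flux_self (grad (y - η))
  -- The weak form tested with `y - η`, after adding the vanishing sum `(div τ, w) + (τ, ∇w)` for `w
  -- = y - η`.
  have h2 : ⟪P.flux (grad (y - η)), grad (y - η)⟫
      = ⟪P.f + v + τ.div, fn (y - η)⟫ + ⟪τ.field - P.flux (grad η), grad (y - η)⟫ := by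
    have e1 := hy (y - η)
    have e2 := τ.inner_div (y - η)
    rw [show P.flux (grad (y - η)) = P.flux (grad y) - P.flux (grad η) by
      rw [grad_sub, flux_sub], inner_sub_left, inner_add_left, inner_sub_left]
    linear_combination e1 - e2
  have h3 := real_inner_le_norm (P.f + v + τ.div) (fn (y - η))
  have h4 := real_inner_le_norm (τ.field - P.flux (grad η)) (grad (y - η))
  have h5 := mul_le_mul_of_nonneg_left (hC.2 (y - η)) (norm_nonneg (P.f + v + τ.div))
  linarith

theorem cost_le_costMajorant {v : L2 P.Ω} {y : H10 P.Ω} (hy : P.IsState v y) {C : ℝ}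
    (hC : IsFriedrichsConstant P.Ω C) (η : H10 P.Ω) (τ : HDiv P.Ω) {α β : ℝ} (hα : 0 < α)
    (hβ : 0 < β) : P.cost y v ≤ P.costMajorant C α β η τ v := by
  have hC0 := hC.1
  have hν := P.ν_lo_pos
  have h1 := hy.norm_grad_sub_le hC η τ
  have h2 := hC.2 (y - η)
  rw [fn_sub] at h2
  have h3 : ‖fn y - P.y_d‖ ≤ ‖fn η - P.y_d‖ + ‖fn y - fn η‖ := by
    rw [add_comm]; exact norm_sub_le_norm_sub_add_norm_sub _ _ _
  rw [cost, costMajorant]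
  have hs : 0 ≤ ‖fn y - P.y_d‖ := norm_nonneg _
  have hn : 0 ≤ ‖fn y - fn η‖ := norm_nonneg _
  generalize ‖fn y - P.y_d‖ = s at *
  generalize ‖fn η - P.y_d‖ = a at *
  generalize ‖fn y - fn η‖ = b at *
  generalize ‖grad (y - η)‖ = g at *
  generalize ‖P.f + v + τ.div‖ = r at *
  generalize ‖τ.field - P.flux (grad η)‖ = q at *
  generalize P.ν_lo = n at *
  have hb : b ≤ C * q / n + C ^ 2 * r / n := by
    rw [← add_div, le_div_iff₀ hν]
    nlinarith [mul_le_mul_of_nonneg_right h2 hν.le, mul_le_mul_of_nonneg_left h1 hC0.le]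
  have e1 : (1 + α) * (1 + β) * C ^ 2 / (2 * α * n ^ 2) * q ^ 2
      = (1 + α) / (2 * α) * ((1 + β) * (C * q / n) ^ 2) := by field_simp
  have e2 : (1 + α) * (1 + β) * C ^ 4 / (2 * α * β * n ^ 2) * r ^ 2
      = (1 + α) / (2 * α) * ((1 + β) / β * (C ^ 2 * r / n) ^ 2) := by field_simp
  rw [e1, e2]
  generalize C * q / n = q' at *
  generalize C ^ 2 * r / n = r' at *
  -- Used with `γ = α` to split off `η - y_d`, and with `γ = β` to separate the two residuals.
  have young : ∀ {γ : ℝ}, 0 < γ → ∀ p q : ℝ, (p + q) ^ 2 ≤ (1 + γ) * p ^ 2 + (1 + γ) / γ * q ^ 2 := by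
    intro γ hγ p q
    have : (1 + γ) * p ^ 2 + (1 + γ) / γ * q ^ 2 - (p + q) ^ 2 = (γ * p - q) ^ 2 / γ := by
      field_simp; ring
    have : 0 ≤ (γ * p - q) ^ 2 / γ := by positivity
    linarith
  have y1 : s ^ 2 ≤ (a + b) ^ 2 := by gcongr
  have y2 := young hα a b
  have y3 : b ^ 2 ≤ (q' + r') ^ 2 := by gcongr
  have y4 := mul_le_mul_of_nonneg_left (y3.trans (young hβ q' r'))
    (show 0 ≤ (1 + α) / (2 * α) by positivity)
  have e3 : (1 + α) / α * b ^ 2 = 2 * ((1 + α) / (2 * α) * b ^ 2) := by field_simp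
  linarith

theorem costMinorant_le_cost {u : L2 P.Ω} {y : H10 P.Ω} (hu : u ∈ P.Uad) (hy : P.IsState u y)
    {C : ℝ} (hC : IsFriedrichsConstant P.Ω C) (η ζ : H10 P.Ω) (τ ρ : HDiv P.Ω) :
    P.costMinorant C η ζ τ ρ (P.projControl ζ) ≤ P.cost y u := by
  have hC0 := hC.1
  have hν := P.ν_lo_pos
  have hl := P.lam_pos
  have h1 := projControl_variational_inequality ζ hu
  generalize P.projControl ζ = v at *
  -- An identity for arbitrary `v`: the state equation tested with `ζ`, both integrations by parts,
  -- and the symmetry of the flux. Of `v_ζ` only `h1` is used from here on.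
  have h2 : P.cost y u = 1 / 2 * ‖fn η - P.y_d‖ ^ 2 + P.lam / 2 * ‖v - P.u_d‖ ^ 2
      + ⟪P.f + v + τ.div, fn ζ⟫ + ⟪τ.field - P.flux (grad η), grad ζ⟫
      + (⟪fn η - P.y_d + ρ.div, fn (y - η)⟫ + ⟪ρ.field - P.flux (grad ζ), grad (y - η)⟫)
      + 1 / 2 * ‖fn (y - η)‖ ^ 2 + P.lam / 2 * ‖u - v‖ ^ 2
      + ⟪P.lam • (v - P.u_d) + fn ζ, u - v⟫ := by
    have e1 : fn y - P.y_d = (fn η - P.y_d) + fn (y - η) := by rw [fn_sub]; abel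
    have e2 : u - P.u_d = (v - P.u_d) + (u - v) := by abel
    have e3 := τ.inner_div ζ
    have e4 := ρ.inner_div (y - η)
    have e5 := hy ζ
    have e6 := P.inner_flux_comm (grad ζ) (grad (y - η))
    rw [grad_sub, flux_sub, inner_sub_left, ← grad_sub] at e6
    rw [cost, e1, e2, norm_add_sq_real (fn η - P.y_d), norm_add_sq_real (v - P.u_d),
      inner_add_left (fn η - P.y_d) ρ.div, inner_add_left (P.lam • (v - P.u_d)),
      real_inner_smul_left, real_inner_comm (u - v) (fn ζ), inner_sub_left u v]
    simp only [inner_add_left, inner_sub_left τ.field, inner_sub_left ρ.field] at e5 ⊢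
    linear_combination -e3 - e4 + e6 + e5
  have h3 := hy.norm_grad_sub_le hC η τ
  have h4 : ‖P.f + u + τ.div‖ ≤ ‖P.f + v + τ.div‖ + ‖u - v‖ := by
    rw [show P.f + u + τ.div = (P.f + v + τ.div) + (u - v) by abel]
    exact norm_add_le _ _
  have h5 := (abs_le.1 (abs_real_inner_le_norm (fn η - P.y_d + ρ.div) (fn (y - η)))).1
  have h6 := (abs_le.1 (abs_real_inner_le_norm (ρ.field - P.flux (grad ζ)) (grad (y - η)))).1
  have h7 := mul_le_mul_of_nonneg_left (hC.2 (y - η)) (norm_nonneg (fn η - P.y_d + ρ.div))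
  rw [h2, costMinorant]
  have hE : 0 ≤ C * ‖fn η - P.y_d + ρ.div‖ + ‖ρ.field - P.flux (grad ζ)‖ := by positivity
  have hR : P.ν_lo * ‖grad (y - η)‖ ≤ C * ‖P.f + v + τ.div‖ + ‖τ.field - P.flux (grad η)‖
      + C * ‖u - v‖ := by
    linarith [mul_le_mul_of_nonneg_left h4 hC0.le]
  have e : C ^ 3 / (P.lam * P.ν_lo) * ‖fn η - P.y_d + ρ.div‖
        + C ^ 2 / (P.lam * P.ν_lo) * ‖ρ.field - P.flux (grad ζ)‖
      = C ^ 2 / (P.lam * P.ν_lo) * (C * ‖fn η - P.y_d + ρ.div‖ + ‖ρ.field - P.flux (grad ζ)‖) := by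
    ring
  rw [e, add_assoc (C ^ 2 / (P.lam * P.ν_lo) * _)]
  have h8 : (C * ‖fn η - P.y_d + ρ.div‖ + ‖ρ.field - P.flux (grad ζ)‖) * ‖grad (y - η)‖
      = ‖fn η - P.y_d + ρ.div‖ * (C * ‖grad (y - η)‖)
        + ‖ρ.field - P.flux (grad ζ)‖ * ‖grad (y - η)‖ := by ring
  have h9 : 0 ≤ ‖fn (y - η)‖ ^ 2 := by positivity
  generalize C * ‖fn η - P.y_d + ρ.div‖ + ‖ρ.field - P.flux (grad ζ)‖ = E at *
  generalize C * ‖P.f + v + τ.div‖ + ‖τ.field - P.flux (grad η)‖ = T at *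
  generalize ‖u - v‖ = s at *
  have key : E * ‖grad (y - η)‖
      ≤ 1 / P.ν_lo * E * (C ^ 2 / (P.lam * P.ν_lo) * E + T) + P.lam / 2 * s ^ 2 := by
    have k1 : ‖grad (y - η)‖ ≤ (T + C * s) / P.ν_lo := by
      rw [le_div_iff₀ hν]; linarith
    have k2 := mul_le_mul_of_nonneg_left k1 hE
    -- Completing the square in `s = ‖u - v‖`. Absorbing the cross term needs only half of the `E²`
    -- coefficient in `R`; the other half is the first square.
    have k3 : 1 / P.ν_lo * E * (C ^ 2 / (P.lam * P.ν_lo) * E + T) + P.lam / 2 * s ^ 2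
        - E * ((T + C * s) / P.ν_lo)
        = ((C * E / P.ν_lo) ^ 2 + (C * E / P.ν_lo - P.lam * s) ^ 2) / (2 * P.lam) := by
      field_simp; ring
    have k4 : 0 ≤ ((C * E / P.ν_lo) ^ 2 + (C * E / P.ν_lo - P.lam * s) ^ 2) / (2 * P.lam) := by
      positivity
    linarith
  linarith

theorem costMajorant_sub_costMinorant (C α β : ℝ) (η ζ : H10 P.Ω) (τ ρ : HDiv P.Ω) (v : L2 P.Ω) :
    P.costMajorant C α β η τ v - P.costMinorant C η ζ τ ρ v
      = P.errorMajorant C α β η ζ τ ρ v := by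
  rw [costMajorant, costMinorant, errorMajorant]
  ring

end ControlProblem

end EllipticControl

theorem mainTheorem2 {d : ℕ} (P : EllipticControl.ControlProblem d)
    (y : EllipticControl.H10 P.Ω) (u : EllipticControl.L2 P.Ω) (hu : P.IsOptimal y u)
    (C_F : ℝ) (hC : EllipticControl.IsFriedrichsConstant P.Ω C_F)
    (ζ : EllipticControl.H10 P.Ω)
    (yζ : EllipticControl.H10 P.Ω) (hyζ : P.IsState (P.projControl ζ) yζ)
    (η : EllipticControl.H10 P.Ω) (τ ρ : EllipticControl.HDiv P.Ω)
    (α β : ℝ) (hα : 0 < α) (hβ : 0 < β) :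
    P.projControl ζ ∈ P.Uad ∧
    P.combinedNormSq y yζ u (P.projControl ζ)
      ≤ P.costMajorant C_F α β η τ (P.projControl ζ)
        - P.costMinorant C_F η ζ τ ρ (P.projControl ζ) ∧
    P.costMajorant C_F α β η τ (P.projControl ζ)
        - P.costMinorant C_F η ζ τ ρ (P.projControl ζ)
      = P.errorMajorant C_F α β η ζ τ ρ (P.projControl ζ) := by
  have hmem := EllipticControl.ControlProblem.projControl_mem_Uad ζ
  exact ⟨hmem, (hu.combinedNormSq_le hmem hyζ).trans (sub_le_sub
    (EllipticControl.ControlProblem.cost_le_costMajorant hyζ hC η τ hα hβ)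
    (EllipticControl.ControlProblem.costMinorant_le_cost hu.1 hu.2.1 hC η ζ τ ρ)),
    EllipticControl.ControlProblem.costMajorant_sub_costMinorant C_F α β η ζ τ ρ _⟩
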